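/- **Definitions.** A *domain preorder* is a set $X$ with two relations $\le$ and $\sqsubseteq$ such that $(X,\le)$ is an $\omega$-complete partial order with a least element $\bot$, and $\sqsubseteq$ is a preorder such that (a) $\bot\sqsubseteq x$ implies $x=\bot$, and (b) if $(x_n)$ and $(y_n)$ are $\le$-$\omega$-chains with $x_n\sqsubseteq y_n$ for all $n$, then $\bigvee_n x_n\sqsubseteq\bigvee_n y_n$. It is *pointed* if it has a $\sqsubseteq$-least element $\mho$. A *continuous function* of domain preorders is a function that is $\omega$-continuous for $\le$ and monotone for $\sqsubseteq$; an *isomorphism* is a continuous function with a continuous two-sided inverse. The product $X\times Y$ and the set $X\to Y$ of continuous functions carry the pointwise relations. $\mathbb N_\bot$ is the flat domain on $\mathbb N$ with $\sqsubseteq$ equal to equality. $X_\mho$ is $X$ with one new element $\mho$, where $\le$ and $\sqsubseteq$ extend those of $X$, $\mho$ is $\sqsubseteq$-least, and in $\le$ the new element $\mho$ is related only to itself and to $\bot\le\mho$; elements of $X$ are regarded as elements of $X_\mho$. The wedge sum $X\oplus Y$ is the disjoint union with $\bot_X$ and $\bot_Y$ identified; each of its relations extends those of $X$ and $Y$, and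 for $x\in X$, $y\in Y$ one has $x\le y$ iff $x=\bot$; $x\sqsubseteq y$ iff $x\sqsubseteq\bot$ and $y=\bot$; and symmetrically with $X$ and $Y$ exchanged. **Theorem.** There exist a domain preorder $D$ and an isomorphism of domain preorders $$ i : D\;\cong\;(\mathbb N_\bot)_\mho\oplus(D_\mho\times D_\mho)\oplus(D_\mho\to D_\mho) $$ such that the following hold. 1. (Type error and divergence are separated.) In $D_\mho$, $\mho\ne\bot$. For every domain preorder $G$, the constant function $\mho$ is $\sqsubseteq$-least among the continuous functions $G\to D_\mho$, and the constant function $\bot$ is not $\sqsubseteq$ the constant function $\mho$. 2. (Product casts.) There are continuous functions $e_\times:D_\mho\times D_\mho\to D_\mho$ and $p_\times:D_\mho\to D_\mho\times D_\mho$ with $e_\times(t)=i^{-1}(t)$ and $p_\times(e_\times(t))=t$ for all $t$, $p_\times(\mho)=\mho$ (that is, $(\mho,\mho)$), $p_\times(\bot)=\bot$, and $p_\times(i^{-1}(z))=\mho$ for every $z\neq\bot$ in the summand $(\mathbb N_\bot)_\mho$ or in the summand $D_\mho\to D_\mho$. 3. (Function casts.) There are continuous functions $e_\to:(D_\mho\to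 D_\mho)\to D_\mho$ and $p_\to:D_\mho\to(D_\mho\to D_\mho)$ with $e_\to(f)=i^{-1}(f)$ and $p_\to(e_\to(f))=f$ for all $f$, $p_\to(\mho)=\mho$ (the constant function $\mho$), $p_\to(\bot)=\bot$, and $p_\to(i^{-1}(z))=\mho$ for every $z\neq\bot$ in the summand $(\mathbb N_\bot)_\mho$ or in the summand $D_\mho\times D_\mho$. -/

import Mathlib

open OmegaCompletePartialOrder

/-- A domain preorder: a pointed `ω`-cpo `(X, ≤)` (the divergence ordering, with `≤`-least element
`⊥`) together with a preorder `⊑` (the error ordering) for which `⊥` is maximal and which is closed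
under suprema of `≤`-`ω`-chains. -/
class DomainPreorder (X : Type*) extends OmegaCompletePartialOrder X, OrderBot X where
  errLE : X → X → Prop
  errLE_refl : ∀ x, errLE x x
  errLE_trans : ∀ x y z, errLE x y → errLE y z → errLE x z
  eq_bot_of_bot_errLE : ∀ x, errLE ⊥ x → x = ⊥
  errLE_ωSup : ∀ c d : Chain X, (∀ n, errLE (c n) (d n)) → errLE (ωSup c) (ωSup d)

infix:50 " ⊑ " => DomainPreorder.errLE

/-- A pointed domain preorder: a domain preorder with a `⊑`-least element `℧`. -/
class PointedDomainPreorder (X : Type*) extends DomainPreorder X where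
  mho : X
  mho_errLE : ∀ x, errLE mho x

notation "℧" => PointedDomainPreorder.mho

/-- Continuous functions of domain preorders: `≤`-continuous and `⊑`-monotone. -/
structure DomainHom (X Y : Type*) [DomainPreorder X] [DomainPreorder Y] where
  toFun : X → Y
  continuous' : ωScottContinuous toFun
  errMono' : ∀ x y, x ⊑ y → toFun x ⊑ toFun y

namespace DomainHom

variable {X Y : Type*} [DomainPreorder X] [DomainPreorder Y]

instance : FunLike (DomainHom X Y) X Y where
  coe := toFun
  coe_injective f g h := by cases f; cases g; congr

@[ext] theorem ext {f g : DomainHom X Y} (h : ∀ x, f x = g x) : f = g := DFunLike.ext f g h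

/-- The divergence ordering on continuous functions is pointwise. -/
instance : PartialOrder (DomainHom X Y) := PartialOrder.lift (fun f x => f x) DFunLike.coe_injective

theorem le_def {f g : DomainHom X Y} : f ≤ g ↔ ∀ x, f x ≤ g x := Iff.rfl

/-- The chain of values at a point of a chain of continuous functions. -/
def evalChain (c : Chain (DomainHom X Y)) (x : X) : Chain Y :=
  c.map ⟨fun f => f x, fun _ _ h => h x⟩

/-- The pointwise supremum of a chain of continuous functions. -/
def sup (c : Chain (DomainHom X Y)) : DomainHom X Y where
  toFun x := ωSup (evalChain c x)
  continuous' := by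
    refine ωScottContinuous.of_monotone_map_ωSup
      ⟨fun x y h => ωSup_le_ωSup_of_le fun n => ⟨n, (c n).continuous'.monotone h⟩, fun d => ?_⟩
    apply le_antisymm
    · refine ωSup_le _ _ fun n => ?_
      change (c n).toFun (ωSup d) ≤ _
      rw [(c n).continuous'.map_ωSup]
      refine ωSup_le _ _ fun m => ?_
      exact le_ωSup_of_le m (le_ωSup (evalChain c (d m)) n)
    · refine ωSup_le _ _ fun m => ωSup_le _ _ fun n => ?_
      exact le_ωSup_of_le n ((c n).continuous'.monotone (le_ωSup d m))
  errMono' x y h := DomainPreorder.errLE_ωSup _ _ fun n => (c n).errMono' x y h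

/-- The constant function. -/
def const (y : Y) : DomainHom X Y where
  toFun _ := y
  continuous' := ωScottContinuous.const
  errMono' _ _ _ := DomainPreorder.errLE_refl y

/-- The exponential `X → Y`: both orderings and the suprema of chains are pointwise. -/
instance : DomainPreorder (DomainHom X Y) where
  ωSup := sup
  le_ωSup c n := fun x => le_ωSup (evalChain c x) n
  ωSup_le c f h := fun x => ωSup_le (evalChain c x) (f x) fun n => h n x
  bot := const ⊥
  bot_le _ := fun _ => bot_le
  errLE f g := ∀ x, f x ⊑ g x
  errLE_refl f x := DomainPreorder.errLE_refl (f x)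
  errLE_trans _ _ _ h k x := DomainPreorder.errLE_trans _ _ _ (h x) (k x)
  eq_bot_of_bot_errLE f h := ext fun x => DomainPreorder.eq_bot_of_bot_errLE (f x) (h x)
  errLE_ωSup _ _ h x := DomainPreorder.errLE_ωSup _ _ fun n => h n x

instance {Y : Type*} [PointedDomainPreorder Y] : PointedDomainPreorder (DomainHom X Y) where
  mho := const ℧
  mho_errLE f x := PointedDomainPreorder.mho_errLE (f x)

end DomainHom

/-- An isomorphism of domain preorders: mutually inverse continuous functions. -/
structure DomainIso (X Y : Type*) [DomainPreorder X] [DomainPreorder Y] where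
  hom : DomainHom X Y
  inv : DomainHom Y X
  inv_hom : ∀ x, inv (hom x) = x
  hom_inv : ∀ y, hom (inv y) = y

/-- The product: both orderings are pointwise. -/
instance Prod.domainPreorder {X Y : Type*} [DomainPreorder X] [DomainPreorder Y] :
    DomainPreorder (X × Y) where
  bot := (⊥, ⊥)
  bot_le _ := ⟨bot_le, bot_le⟩
  errLE p q := p.1 ⊑ q.1 ∧ p.2 ⊑ q.2
  errLE_refl _ := ⟨DomainPreorder.errLE_refl _, DomainPreorder.errLE_refl _⟩
  errLE_trans _ _ _ h k :=
    ⟨DomainPreorder.errLE_trans _ _ _ h.1 k.1, DomainPreorder.errLE_trans _ _ _ h.2 k.2⟩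
  eq_bot_of_bot_errLE _ h := Prod.ext (DomainPreorder.eq_bot_of_bot_errLE _ h.1)
    (DomainPreorder.eq_bot_of_bot_errLE _ h.2)
  errLE_ωSup _ _ h := ⟨DomainPreorder.errLE_ωSup _ _ fun n => (h n).1,
    DomainPreorder.errLE_ωSup _ _ fun n => (h n).2⟩

instance Prod.pointedDomainPreorder {X Y : Type*} [PointedDomainPreorder X]
    [PointedDomainPreorder Y] : PointedDomainPreorder (X × Y) where
  mho := (℧, ℧)
  mho_errLE _ := ⟨PointedDomainPreorder.mho_errLE _, PointedDomainPreorder.mho_errLE _⟩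

/-- The flat domain `A_⊥` on a set `A`, as `Part A`, with the discrete error ordering. -/
noncomputable instance Part.domainPreorder {A : Type*} : DomainPreorder (Part A) where
  bot := ⊥
  bot_le _ := bot_le
  errLE x y := x = y
  errLE_refl _ := rfl
  errLE_trans _ _ _ := Eq.trans
  eq_bot_of_bot_errLE _ h := h.symm
  errLE_ωSup _ _ h := congrArg ωSup (Chain.ext (funext h))

/-- The underlying set of `X_℧`: `X` with a new element `err` adjoined. -/
inductive WithErr (X : Type*)
  | val : X → WithErr X
  | err : WithErr X

namespace WithErr

variable {X : Type*} [DomainPreorder X]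

/-- The divergence ordering of `X_℧`: that of `X`, and the new element is above `⊥` only. -/
protected inductive Le : WithErr X → WithErr X → Prop
  | val {x y : X} : x ≤ y → WithErr.Le (val x) (val y)
  | err : WithErr.Le err err
  | bot : WithErr.Le (val ⊥) err

/-- The error ordering of `X_℧`: that of `X`, and the new element is below everything. -/
protected inductive ErrLE : WithErr X → WithErr X → Prop
  | val {x y : X} : x ⊑ y → WithErr.ErrLE (val x) (val y)
  | err (y : WithErr X) : WithErr.ErrLE err y

instance : PartialOrder (WithErr X) where
  le := WithErr.Le
  le_refl x := by
    cases x
    · exact .val le_rfl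
    · exact .err
  le_trans x y z h k := by
    cases h with
    | val h =>
      cases k with
      | val k => exact .val (h.trans k)
      | bot => rw [le_bot_iff.mp h]; exact .bot
    | err => exact k
    | bot => cases k; exact .bot
  le_antisymm x y h k := by
    cases h with
    | val h => cases k with | val k => rw [le_antisymm h k]
    | err => rfl
    | bot => cases k

/-- The map `X_℧ → X` that sends the new element to `⊥`. -/
def getD : WithErr X → X
  | val x => x
  | err => ⊥

theorem getD_mono : Monotone (getD (X := X)) := by
  intro x y h
  cases h with
  | val h => exact h
  | err => exact le_rfl
  | bot => exact le_rfl

theorem err_le_iff {x : WithErr X} : err ≤ x ↔ x = err :=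
  ⟨fun h => by cases h; rfl, fun h => h ▸ le_rfl⟩

theorem val_getD {x : WithErr X} (h : x ≠ err) : val (getD x) = x := by
  cases x
  · rfl
  · exact absurd rfl h

theorem val_le_iff {x : X} {y : WithErr X} (h : y ≠ err) : val x ≤ y ↔ x ≤ getD y := by
  cases y
  · exact ⟨fun h => by cases h; assumption, fun h => .val h⟩
  · exact absurd rfl h

open Classical in
/-- Suprema of chains in `X_℧`: a chain that reaches the new element has it as its supremum, any
other chain lives in `X`. -/
noncomputable def sup (c : Chain (WithErr X)) : WithErr X :=
  if ∃ n, c n = err then err else val (ωSup (c.map ⟨getD, getD_mono⟩))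

theorem isLUB_sup (c : Chain (WithErr X)) : IsLUB (Set.range c) (sup c) := by
  unfold sup
  split_ifs with h
  · obtain ⟨n, hn⟩ := h
    refine ⟨?_, fun y hy => hn ▸ hy ⟨n, rfl⟩⟩
    rintro _ ⟨m, rfl⟩
    rcases le_total m n with hmn | hmn
    · exact hn ▸ c.monotone hmn
    · have := c.monotone hmn
      change c n ≤ c m at this
      rw [hn, err_le_iff] at this
      exact this.le
  · push Not at h
    constructor
    · rintro _ ⟨m, rfl⟩
      rw [← val_getD (h m)]
      exact .val (le_ωSup (c.map ⟨getD, getD_mono⟩) m)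
    · intro y hy
      cases y with
      | val y => exact .val (ωSup_le _ _ fun n => getD_mono (hy ⟨n, rfl⟩))
      | err =>
        have : ωSup (c.map ⟨getD, getD_mono⟩) = ⊥ :=
          le_bot_iff.mp (ωSup_le _ _ fun n => getD_mono (hy ⟨n, rfl⟩))
        rw [this]
        exact .bot

theorem val_errLE_sup {c d : Chain (WithErr X)} (h : ∀ n, WithErr.ErrLE (c n) (d n)) :
    WithErr.ErrLE (sup c) (sup d) := by
  by_cases hc : ∃ n, c n = err
  · simp only [sup, hc, if_true]
    exact .err _
  · have hd : ¬ ∃ n, d n = err := by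
      rintro ⟨n, hn⟩
      have := h n
      rw [hn] at this
      apply hc
      refine ⟨n, ?_⟩
      generalize c n = z at this
      cases this
      rfl
    simp only [sup, hc, hd, if_false]
    refine .val (DomainPreorder.errLE_ωSup _ _ fun n => ?_)
    have := h n
    push Not at hc
    have hcn := hc n
    change getD (c n) ⊑ getD (d n)
    generalize c n = z at this hcn
    generalize d n = w at this
    cases this with
    | val h => exact h
    | err => exact absurd rfl hcn

/-- The domain preorder `X_℧`, in which `⊥` is the bottom element of `X`. -/
noncomputable instance : DomainPreorder (WithErr X) where
  ωSup := sup
  le_ωSup c n := (isLUB_sup c).1 ⟨n, rfl⟩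
  ωSup_le c x h := (isLUB_sup c).2 (by rintro _ ⟨n, rfl⟩; exact h n)
  bot := val ⊥
  bot_le x := by
    cases x
    · exact .val bot_le
    · exact .bot
  errLE := WithErr.ErrLE
  errLE_refl x := by
    cases x
    · exact .val (DomainPreorder.errLE_refl _)
    · exact .err _
  errLE_trans x y z h k := by
    cases h with
    | val h => cases k with | val k => exact .val (DomainPreorder.errLE_trans _ _ _ h k)
    | err => exact .err _
  eq_bot_of_bot_errLE x h := by
    cases h with
    | val h => exact congrArg val (DomainPreorder.eq_bot_of_bot_errLE _ h)
  errLE_ωSup _ _ h := val_errLE_sup h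

noncomputable instance : PointedDomainPreorder (WithErr X) where
  mho := err
  mho_errLE y := .err y

end WithErr

/-- The wedge sum `X ⊕ Y`, the disjoint union of `X` and `Y` with their bottom elements identified.
The class of `x : X` is represented by `(x, ⊥)` and that of `y : Y` by `(⊥, y)`; see `Wedge.inl`,
`Wedge.inr` and the facts below for the resulting identifications and orderings. -/
def Wedge (X Y : Type*) [DomainPreorder X] [DomainPreorder Y] : Type _ :=
  {p : X × Y // p.1 = ⊥ ∨ p.2 = ⊥}

namespace Wedge

variable {X Y : Type*} [DomainPreorder X] [DomainPreorder Y]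

/-- The left injection into the wedge sum. -/
def inl (x : X) : Wedge X Y := ⟨(x, ⊥), Or.inr rfl⟩

/-- The right injection into the wedge sum. -/
def inr (y : Y) : Wedge X Y := ⟨(⊥, y), Or.inl rfl⟩

instance : PartialOrder (Wedge X Y) := inferInstanceAs (PartialOrder (Subtype _))

/-- The first coordinates of a chain in the wedge sum. -/
def chain (c : Chain (Wedge X Y)) : Chain (X × Y) :=
  c.map ⟨Subtype.val, fun _ _ h => h⟩

theorem ωSup_mem (c : Chain (Wedge X Y)) : (ωSup (chain c)).1 = ⊥ ∨ (ωSup (chain c)).2 = ⊥ := by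
  by_cases h : ∀ n, (c n).1.1 = ⊥
  · left
    exact le_bot_iff.mp (ωSup_le _ _ fun n => (h n).le)
  · right
    push Not at h
    obtain ⟨n, hn⟩ := h
    refine le_bot_iff.mp (ωSup_le _ _ fun m => ?_)
    have hk : (c (max n m)).1.1 ≠ ⊥ := fun e => hn (le_bot_iff.mp
      (((c.monotone (le_max_left n m) : (c n).1 ≤ (c (max n m)).1).1).trans e.le))
    have h2 := (c (max n m)).2.resolve_left hk
    exact ((c.monotone (le_max_right n m) : (c m).1 ≤ (c (max n m)).1).2).trans h2.le

/-- The domain preorder structure on the wedge sum. -/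
instance : DomainPreorder (Wedge X Y) where
  ωSup c := ⟨ωSup (chain c), ωSup_mem c⟩
  le_ωSup c n := le_ωSup (chain c) n
  ωSup_le c x h := ωSup_le (chain c) x.1 h
  bot := ⟨⊥, Or.inl rfl⟩
  bot_le x := (bot_le : ⊥ ≤ x.1)
  errLE p q := p.1 ⊑ q.1
  errLE_refl _ := DomainPreorder.errLE_refl _
  errLE_trans _ _ _ := DomainPreorder.errLE_trans _ _ _
  eq_bot_of_bot_errLE _ h := Subtype.ext (DomainPreorder.eq_bot_of_bot_errLE _ h)
  errLE_ωSup c d h := DomainPreorder.errLE_ωSup (chain c) (chain d) h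

theorem exists_rep (p : Wedge X Y) : (∃ x, p = inl x) ∨ ∃ y, p = inr y := by
  obtain ⟨⟨x, y⟩, h | h⟩ := p
  · exact Or.inr ⟨y, Subtype.ext (Prod.ext h rfl)⟩
  · exact Or.inl ⟨x, Subtype.ext (Prod.ext rfl h)⟩

theorem inl_inj {x x' : X} : (inl x : Wedge X Y) = inl x' ↔ x = x' :=
  ⟨fun h => congrArg (fun p => p.1.1) h, congrArg inl⟩

theorem inr_inj {y y' : Y} : (inr y : Wedge X Y) = inr y' ↔ y = y' :=
  ⟨fun h => congrArg (fun p => p.1.2) h, congrArg inr⟩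

theorem inl_eq_inr {x : X} {y : Y} : inl x = inr y ↔ x = ⊥ ∧ y = ⊥ :=
  ⟨fun h => ⟨congrArg (fun p => p.1.1) h, (congrArg (fun p => p.1.2) h).symm⟩,
    fun h => Subtype.ext (Prod.ext h.1 h.2.symm)⟩

theorem inl_le_inl {x x' : X} : (inl x : Wedge X Y) ≤ inl x' ↔ x ≤ x' :=
  ⟨fun h => h.1, fun h => ⟨h, le_rfl⟩⟩

theorem inr_le_inr {y y' : Y} : (inr y : Wedge X Y) ≤ inr y' ↔ y ≤ y' :=
  ⟨fun h => h.2, fun h => ⟨le_rfl, h⟩⟩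

theorem inl_le_inr {x : X} {y : Y} : inl x ≤ inr y ↔ x = ⊥ :=
  ⟨fun h => le_bot_iff.mp h.1, fun h => ⟨h.le, bot_le⟩⟩

theorem inr_le_inl {x : X} {y : Y} : inr y ≤ inl x ↔ y = ⊥ :=
  ⟨fun h => le_bot_iff.mp h.2, fun h => ⟨bot_le, h.le⟩⟩

theorem inl_errLE_inl {x x' : X} : (inl x : Wedge X Y) ⊑ inl x' ↔ x ⊑ x' :=
  ⟨fun h => h.1, fun h => ⟨h, DomainPreorder.errLE_refl _⟩⟩

theorem inr_errLE_inr {y y' : Y} : (inr y : Wedge X Y) ⊑ inr y' ↔ y ⊑ y' :=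
  ⟨fun h => h.2, fun h => ⟨DomainPreorder.errLE_refl _, h⟩⟩

theorem inl_errLE_inr {x : X} {y : Y} : inl x ⊑ inr y ↔ x ⊑ ⊥ ∧ y = ⊥ :=
  ⟨fun h => ⟨h.1, DomainPreorder.eq_bot_of_bot_errLE _ h.2⟩,
    fun h => by rw [h.2]; exact ⟨h.1, DomainPreorder.errLE_refl _⟩⟩

theorem inr_errLE_inl {x : X} {y : Y} : inr y ⊑ inl x ↔ y ⊑ ⊥ ∧ x = ⊥ :=
  ⟨fun h => ⟨h.2, DomainPreorder.eq_bot_of_bot_errLE _ h.1⟩,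
    fun h => by rw [h.2]; exact ⟨DomainPreorder.errLE_refl _, h.1⟩⟩

end Wedge

/-- The right-hand side `(ℕ_⊥)_℧ ⊕ (D_℧ × D_℧) ⊕ (D_℧ → D_℧)` of the domain equation. -/
abbrev DynSum (D : Type*) [DomainPreorder D] : Type _ :=
  Wedge (WithErr (Part ℕ))
    (Wedge (WithErr D × WithErr D) (DomainHom (WithErr D) (WithErr D)))

namespace DynSum

variable {D : Type*} [DomainPreorder D]

/-- The number summand. -/
noncomputable def nat (n : WithErr (Part ℕ)) : DynSum D := Wedge.inl n

/-- The pair summand. -/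
noncomputable def pair (t : WithErr D × WithErr D) : DynSum D := Wedge.inr (Wedge.inl t)

/-- The function summand. -/
noncomputable def fn (f : DomainHom (WithErr D) (WithErr D)) : DynSum D := Wedge.inr (Wedge.inr f)

end DynSum

/-! The equation is solved by a bilimit. Let F be its right-hand side, acting on strict functions,
contravariant in the argument of the function summand and covariant elsewhere. The iterates of F on
the one-point domain are linked by embeddings and projections for ≤, and D consists of the families
compatible with the projections. The composites emb n ∘ proj n increase to the identity
(`Bilimit.exhausts_emb_proj`), and F carries such sequences to such sequences
(`DynSum.exhausts_map`). Hence the supremum of the stages F(proj n, emb n) ∘ proj (n+1) is inverse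
to the folding function F(D) → D.

The error ordering needs no limit argument of its own: each stage is ⊑-monotone, and closure of ⊑
under suprema of chains passes this on to the supremum. Functions are strict because adjoining ℧ and
the wedge are functorial only for these.

A cast out of D_℧ unfolds and then raises ℧ on the unwanted summands; this is ⊑-monotone because ⊥
is ⊑-maximal. -/

namespace DomainHom

/-! ### Continuous functions. -/

variable {X Y Z : Type*} [DomainPreorder X] [DomainPreorder Y] [DomainPreorder Z]

theorem mono (f : DomainHom X Y) {x y : X} (h : x ≤ y) : f x ≤ f y := f.continuous'.monotone h

theorem errMono (f : DomainHom X Y) {x y : X} (h : x ⊑ y) : f x ⊑ f y := f.errMono' x y h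

/-- The half of continuity that monotonicity does not give, in the form that `ofLE` asks for. -/
theorem map_ωSup_le (f : DomainHom X Y) (c : Chain X) {z : Y} (h : ∀ n, f (c n) ≤ z) :
    f (ωSup c) ≤ z := by
  have := f.continuous'.map_ωSup c
  change f (ωSup c) = _ at this
  rw [this]
  exact ωSup_le _ _ h

/-- A monotone function preserves suprema of chains if it does so up to upper bounds. -/
def ofLE (f : X → Y) (hm : Monotone f)
    (hs : ∀ (c : Chain X) (z : Y), (∀ n, f (c n) ≤ z) → f (ωSup c) ≤ z)
    (he : ∀ x y, x ⊑ y → f x ⊑ f y) : DomainHom X Y where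
  toFun := f
  continuous' := ωScottContinuous.of_monotone_map_ωSup ⟨hm, fun c =>
    le_antisymm (hs c _ fun n => le_ωSup (c.map ⟨f, hm⟩) n)
      (ωSup_le _ _ fun n => hm (le_ωSup c n))⟩
  errMono' := he

/-- Composition of continuous functions. -/
def comp (g : DomainHom Y Z) (f : DomainHom X Y) : DomainHom X Z :=
  ofLE (fun x => g (f x)) (fun _ _ h => g.mono (f.mono h))
    (fun c z h => by
      have := f.continuous'.map_ωSup c
      change f (ωSup c) = _ at this
      rw [this]
      exact g.map_ωSup_le _ h)
    (fun _ _ h => g.errMono (f.errMono h))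

end DomainHom

/-! ### Strict functions. -/

/-- Continuous functions that preserve the least element. -/
structure StrictHom (X Y : Type*) [DomainPreorder X] [DomainPreorder Y] extends
    DomainHom X Y where
  map_bot' : toFun ⊥ = ⊥

namespace StrictHom

variable {X Y Z : Type*} [DomainPreorder X] [DomainPreorder Y] [DomainPreorder Z]

instance : FunLike (StrictHom X Y) X Y where
  coe f := f.toFun
  coe_injective f g h := by
    obtain ⟨f, _⟩ := f
    obtain ⟨g, _⟩ := g
    have : f = g := DFunLike.coe_injective h
    subst this
    rfl

@[ext] theorem ext {f g : StrictHom X Y} (h : ∀ x, f x = g x) : f = g := DFunLike.ext f g h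

@[simp] theorem map_bot (f : StrictHom X Y) : f ⊥ = ⊥ := f.map_bot'

theorem mono (f : StrictHom X Y) {x y : X} (h : x ≤ y) : f x ≤ f y := f.toDomainHom.mono h

theorem errMono (f : StrictHom X Y) {x y : X} (h : x ⊑ y) : f x ⊑ f y :=
  f.toDomainHom.errMono h

/-- The identity. -/
def id : StrictHom X X where
  toDomainHom := DomainHom.ofLE (fun x => x) (fun _ _ h => h) (fun c _ h => ωSup_le c _ h)
    (fun _ _ h => h)
  map_bot' := rfl

/-- Composition of strict functions. -/
def comp (g : StrictHom Y Z) (f : StrictHom X Y) : StrictHom X Z where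
  toDomainHom := g.toDomainHom.comp f.toDomainHom
  map_bot' := (congrArg g f.map_bot).trans g.map_bot

/-- The constant function `⊥`. -/
def zero : StrictHom X Y where
  toDomainHom := ⊥
  map_bot' := rfl

open Classical in
/-- The function that sends every element other than `⊥` to the error. -/
noncomputable def raise {Y : Type*} [PointedDomainPreorder Y] : StrictHom X Y where
  toDomainHom := DomainHom.ofLE (fun x => if x = ⊥ then ⊥ else ℧)
    (fun x y h => by
      by_cases hx : x = ⊥
      · simp [hx]
      · have hy : y ≠ ⊥ := fun e => hx (le_bot_iff.mp (h.trans e.le))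
        simp [hx, hy])
    (fun c z h => by
      by_cases hc : ωSup c = ⊥
      · simp [hc]
      · have : ∃ n, c n ≠ ⊥ := by
          by_contra! hn
          exact hc (le_bot_iff.mp (ωSup_le _ _ fun n => (hn n).le))
        obtain ⟨n, hn⟩ := this
        simpa [hc, hn] using h n)
    (fun x y h => by
      by_cases hx : x = ⊥
      · subst hx
        -- Maximality of ⊥ excludes the one bad case, where `x` goes to ⊥ and `y` to ℧.
        rw [DomainPreorder.eq_bot_of_bot_errLE _ h]
        exact DomainPreorder.errLE_refl _
      · simp only [hx, if_false]
        exact PointedDomainPreorder.mho_errLE _)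
  map_bot' := if_pos rfl

theorem raise_of_ne {Y : Type*} [PointedDomainPreorder Y] {x : X} (h : x ≠ ⊥) :
    (raise : StrictHom X Y) x = ℧ := if_neg h

/-- Postcomposition and precomposition on the exponential. -/
def arrow {X' Y' : Type*} [DomainPreorder X'] [DomainPreorder Y'] (f : StrictHom X' X)
    (g : StrictHom Y Y') : StrictHom (DomainHom X Y) (DomainHom X' Y') where
  toDomainHom := DomainHom.ofLE (fun h => (g.toDomainHom.comp h).comp f.toDomainHom)
    (fun _ _ h x => g.mono (h (f x)))
    (fun c _ h x => g.map_ωSup_le (DomainHom.evalChain c (f x)) fun n => h n x)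
    (fun _ _ h x => g.errMono (h (f x)))
  map_bot' := DomainHom.ext fun _ => g.map_bot

/-- The product of two strict functions. -/
def prodMap {X' Y' : Type*} [DomainPreorder X'] [DomainPreorder Y'] (f : StrictHom X X')
    (g : StrictHom Y Y') : StrictHom (X × Y) (X' × Y') where
  toDomainHom := DomainHom.ofLE (fun p => (f p.1, g p.2))
    (fun _ _ h => ⟨f.mono h.1, g.mono h.2⟩)
    (fun _ _ h => ⟨f.map_ωSup_le _ fun n => (h n).1, g.map_ωSup_le _ fun n => (h n).2⟩)
    (fun _ _ h => ⟨f.errMono h.1, g.errMono h.2⟩)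
  map_bot' := Prod.ext f.map_bot g.map_bot

/-! ### Sequences increasing to the identity. -/

/-- A sequence of strict endofunctions that increases to the identity. -/
structure Exhausts (ρ : ℕ → StrictHom X X) : Prop where
  mono' : ∀ m n, m ≤ n → ∀ x, ρ m x ≤ ρ n x
  le' : ∀ n x, ρ n x ≤ x
  least : ∀ x z, (∀ n, ρ n x ≤ z) → x ≤ z

namespace Exhausts

variable {ρ : ℕ → StrictHom X X} {σ : ℕ → StrictHom Y Y}

/-- Since `x` is the supremum of the chain `ρ n x`, continuity reduces bounds on `h x` to the
approximants. -/
theorem map_le (hρ : Exhausts ρ) (h : DomainHom X Y) {x : X} {z : Y} (hz : ∀ n, h (ρ n x) ≤ z) :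
    h x ≤ z := by
  let c : Chain X := ⟨fun n => ρ n x, fun m n hmn => hρ.mono' m n hmn x⟩
  exact (h.mono (hρ.least x (ωSup c) fun n => le_ωSup c n)).trans (h.map_ωSup_le c hz)

theorem id : Exhausts fun _ => (StrictHom.id : StrictHom X X) :=
  ⟨fun _ _ _ _ => le_rfl, fun _ _ => le_rfl, fun _ _ h => h 0⟩

theorem prodMap (hρ : Exhausts ρ) (hσ : Exhausts σ) :
    Exhausts fun n => (ρ n).prodMap (σ n) :=
  ⟨fun m n h p => ⟨hρ.mono' m n h p.1, hσ.mono' m n h p.2⟩,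
    fun n p => ⟨hρ.le' n p.1, hσ.le' n p.2⟩,
    fun p z h => ⟨hρ.least p.1 z.1 fun n => (h n).1, hσ.least p.2 z.2 fun n => (h n).2⟩⟩

/-- Approximating argument and value separately gives two indices; monotonicity merges them into
their maximum. -/
theorem arrow (hρ : Exhausts ρ) (hσ : Exhausts σ) : Exhausts fun n => (ρ n).arrow (σ n) :=
  ⟨fun m n h f x => (hσ.mono' m n h _).trans ((σ n).mono (f.mono (hρ.mono' m n h x))),
    fun n f x => (hσ.le' n _).trans (f.mono (hρ.le' n x)),
    fun f _ h x => hρ.map_le f fun n => hσ.least _ _ fun m =>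
      ((hσ.mono' m _ (le_max_left m n) _).trans ((σ _).mono (f.mono
        (hρ.mono' n _ (le_max_right m n) x)))).trans (h (max m n) x)⟩

end Exhausts

end StrictHom

/-! ### Functoriality of adjoining an error. -/

namespace WithErr

variable {X Y Z : Type*} [DomainPreorder X] [DomainPreorder Y] [DomainPreorder Z]

/-- The inclusion of `X` into `X_℧`. -/
noncomputable def valHom : StrictHom X (WithErr X) where
  toDomainHom := DomainHom.ofLE val (fun _ _ h => .val h)
    (fun c z h => by
      cases z with
      | val z => exact .val (ωSup_le _ _ fun n => getD_mono (h n))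
      | err =>
        have : ωSup c = ⊥ := le_bot_iff.mp (ωSup_le _ _ fun n => getD_mono (h n))
        rw [this]
        exact .bot)
    (fun _ _ h => .val h)
  map_bot' := rfl

/-- The extension of a strict function into a pointed domain preorder that preserves the error. -/
noncomputable def lift {Z : Type*} [PointedDomainPreorder Z] (f : StrictHom X Z) :
    StrictHom (WithErr X) Z where
  toDomainHom := DomainHom.ofLE (fun x => match x with | val x => f x | err => ℧)
    (fun x y h => by
      cases h with
      | val h => exact f.mono h
      | err => exact le_rfl
      -- Strictness is essential here: ⊥ lies below the error, so its image must lie below ℧.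
      | bot => exact f.map_bot.le.trans bot_le)
    (fun c z h => by
      change (match sup c with | val x => f x | err => ℧) ≤ z
      unfold sup
      split_ifs with hc
      · obtain ⟨n, hn⟩ := hc
        have := h n
        rwa [hn] at this
      · push Not at hc
        refine f.map_ωSup_le _ fun n => ?_
        have := h n
        rwa [← val_getD (hc n)] at this)
    (fun x y h => by
      cases h with
      | val h => exact f.errMono h
      | err => exact PointedDomainPreorder.mho_errLE _)
  map_bot' := f.map_bot

/-- The action of `X ↦ X_℧` on strict functions. -/
noncomputable def map (f : StrictHom X Y) : StrictHom (WithErr X) (WithErr Y) :=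
  lift (valHom.comp f)

@[simp] theorem map_id (x : WithErr X) : map StrictHom.id x = x := by cases x <;> rfl

@[simp] theorem map_map (g : StrictHom Y Z) (f : StrictHom X Y) (x : WithErr X) :
    map g (map f x) = map (g.comp f) x := by cases x <;> rfl

theorem map_le_map {f g : StrictHom X Y} (h : ∀ x, f x ≤ g x) (x : WithErr X) :
    map f x ≤ map g x := by
  cases x
  · exact .val (h _)
  · exact .err

theorem exhausts_map {ρ : ℕ → StrictHom X X} (hρ : StrictHom.Exhausts ρ) :
    StrictHom.Exhausts fun n => map (ρ n) where
  mono' m n h x := map_le_map (hρ.mono' m n h) x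
  le' n x := by
    cases x
    · exact .val (hρ.le' n _)
    · exact .err
  least x z h := by
    cases x with
    | val x => exact hρ.map_le valHom.toDomainHom h
    | err => exact h 0

end WithErr

/-! ### Functoriality and universal maps of the wedge sum. -/

namespace Wedge

variable {X Y X' Y' Z : Type*} [DomainPreorder X] [DomainPreorder Y] [DomainPreorder X']
  [DomainPreorder Y'] [DomainPreorder Z]

/-- The left injection is strict and continuous. -/
def inlHom : StrictHom X (Wedge X Y) where
  toDomainHom := DomainHom.ofLE inl (fun _ _ h => inl_le_inl.mpr h)
    (fun c z h => ⟨ωSup_le c z.1.1 fun n => (h n).1, (bot_le : ⊥ ≤ z.1.2)⟩)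
    (fun _ _ h => inl_errLE_inl.mpr h)
  map_bot' := rfl

/-- The right injection is strict and continuous. -/
def inrHom : StrictHom Y (Wedge X Y) where
  toDomainHom := DomainHom.ofLE inr (fun _ _ h => inr_le_inr.mpr h)
    (fun c z h => ⟨(bot_le : ⊥ ≤ z.1.1), ωSup_le c z.1.2 fun n => (h n).2⟩)
    (fun _ _ h => inr_errLE_inr.mpr h)
  map_bot' := rfl

/-- The action of the wedge sum on strict functions. -/
def map (f : StrictHom X X') (g : StrictHom Y Y') : StrictHom (Wedge X Y) (Wedge X' Y') where
  toDomainHom := DomainHom.ofLE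
    -- Strictness keeps one of the two coordinates equal to ⊥.
    (fun p => ⟨(f p.1.1, g p.1.2), p.2.imp (fun h => by simp [h]) (fun h => by simp [h])⟩)
    (fun _ _ h => ⟨f.mono h.1, g.mono h.2⟩)
    (fun c _ h => ⟨f.map_ωSup_le ((chain c).map ⟨Prod.fst, monotone_fst⟩) fun n => (h n).1,
      g.map_ωSup_le ((chain c).map ⟨Prod.snd, monotone_snd⟩) fun n => (h n).2⟩)
    (fun _ _ h => ⟨f.errMono h.1, g.errMono h.2⟩)
  map_bot' := Subtype.ext (Prod.ext f.map_bot g.map_bot)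

theorem exhausts_map {ρ : ℕ → StrictHom X X} {σ : ℕ → StrictHom Y Y}
    (hρ : StrictHom.Exhausts ρ) (hσ : StrictHom.Exhausts σ) :
    StrictHom.Exhausts fun n => map (ρ n) (σ n) :=
  ⟨fun m n h p => ⟨hρ.mono' m n h p.1.1, hσ.mono' m n h p.1.2⟩,
    fun n p => ⟨hρ.le' n p.1.1, hσ.le' n p.1.2⟩,
    fun p z h => ⟨hρ.least p.1.1 z.1.1 fun n => (h n).1, hσ.least p.1.2 z.1.2 fun n => (h n).2⟩⟩

open Classical in
/-- The function on a wedge sum given by strict functions on the summands. -/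
noncomputable def desc (f : StrictHom X Z) (g : StrictHom Y Z) : StrictHom (Wedge X Y) Z where
  toDomainHom := DomainHom.ofLE (fun p => if p.1.1 = ⊥ then g p.1.2 else f p.1.1)
    (fun p q h => by
      by_cases hp : p.1.1 = ⊥ <;> by_cases hq : q.1.1 = ⊥ <;> simp only [hp, hq, if_true, if_false]
      · exact g.mono h.2
      · have : p.1.2 = ⊥ := le_bot_iff.mp (h.2.trans (q.2.resolve_left hq).le)
        simp [this]
      · exact absurd (le_bot_iff.mp (h.1.trans hq.le)) hp
      · exact f.mono h.1)
    (fun c z h => by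
      change (if (ωSup (chain c)).1 = ⊥ then g (ωSup (chain c)).2 else f (ωSup (chain c)).1) ≤ z
      split_ifs with hc
      · refine g.map_ωSup_le _ fun n => ?_
        have hn : (c n).1.1 = ⊥ := le_bot_iff.mp ((le_ωSup (chain c) n).1.trans hc.le)
        have := h n
        rwa [if_pos hn] at this
      · refine f.map_ωSup_le _ fun n => ?_
        change f (c n).1.1 ≤ z
        -- The chain may start at ⊥ before it enters the left summand; strictness of `f` makes these
        -- terms harmless.
        by_cases hn : (c n).1.1 = ⊥
        · simp [hn]
        · have := h n
          rwa [if_neg hn] at this)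
    (fun p q h => by
      have h₁ : p.1.1 ⊑ q.1.1 := h.1
      have h₂ : p.1.2 ⊑ q.1.2 := h.2
      by_cases hp : p.1.1 = ⊥ <;> by_cases hq : q.1.1 = ⊥ <;> simp only [hp, hq, if_true, if_false]
      · exact g.errMono h.2
      · rw [hp] at h₁
        exact absurd (DomainPreorder.eq_bot_of_bot_errLE _ h₁) hq
      -- A relation from the left summand to the right one can only end at ⊥, so `f p.1.1 ⊑ f ⊥ = ⊥`
      -- suffices.
      · rw [p.2.resolve_left hp] at h₂
        rw [hq] at h₁
        have := f.errMono h₁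
        rw [f.map_bot] at this
        have hg : g q.1.2 = ⊥ :=
          (congrArg g (DomainPreorder.eq_bot_of_bot_errLE _ h₂)).trans g.map_bot
        exact hg.symm.subst (motive := fun z => f p.1.1 ⊑ z) this
      · exact f.errMono h₁)
  map_bot' := (if_pos rfl).trans g.map_bot

@[simp] theorem desc_inl (f : StrictHom X Z) (g : StrictHom Y Z) (x : X) :
    desc f g (inl x) = f x := by
  classical
  change (if x = ⊥ then g ⊥ else f x) = f x
  split_ifs with h <;> simp [h]

@[simp] theorem desc_inr (f : StrictHom X Z) (g : StrictHom Y Z) (y : Y) :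
    desc f g (inr y) = g y := if_pos rfl

end Wedge

/-! ### The right-hand side as a functor of mixed variance. -/

namespace DynSum

variable {X Y Z : Type*} [DomainPreorder X] [DomainPreorder Y] [DomainPreorder Z]

/-- The action of the right-hand side of the domain equation on a pair of opposite functions. -/
noncomputable def map (f : StrictHom Y X) (g : StrictHom X Y) :
    StrictHom (DynSum X) (DynSum Y) :=
  Wedge.map StrictHom.id (Wedge.map ((WithErr.map g).prodMap (WithErr.map g))
    ((WithErr.map f).arrow (WithErr.map g)))

theorem map_id (y : DynSum X) : map StrictHom.id StrictHom.id y = y := by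
  refine Subtype.ext (Prod.ext rfl (Subtype.ext (Prod.ext (Prod.ext ?_ ?_) ?_)))
  · exact WithErr.map_id _
  · exact WithErr.map_id _
  · refine DomainHom.ext fun x => (WithErr.map_id _).trans ?_
    exact congrArg y.1.2.1.2 (WithErr.map_id x)

theorem map_map (f' : StrictHom Z Y) (g' : StrictHom Y Z) (f : StrictHom Y X) (g : StrictHom X Y)
    (y : DynSum X) : map f' g' (map f g y) = map (f.comp f') (g'.comp g) y := by
  refine Subtype.ext (Prod.ext rfl (Subtype.ext (Prod.ext (Prod.ext ?_ ?_) ?_)))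
  · exact WithErr.map_map _ _ _
  · exact WithErr.map_map _ _ _
  · refine DomainHom.ext fun x => (WithErr.map_map _ _ _).trans ?_
    exact congrArg (fun z => WithErr.map (g'.comp g) (y.1.2.1.2 z)) (WithErr.map_map _ _ x)

/-- Increasing `f` increases the result despite the contravariance, because the functions in the
exponential are monotone. -/
theorem map_le_map {f f' : StrictHom Y X} {g g' : StrictHom X Y} (hf : ∀ x, f x ≤ f' x)
    (hg : ∀ x, g x ≤ g' x) (y : DynSum X) : map f g y ≤ map f' g' y :=
  ⟨le_rfl, ⟨WithErr.map_le_map hg _, WithErr.map_le_map hg _⟩, fun x =>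
    (WithErr.map_le_map hg _).trans ((WithErr.map g').mono
      (y.1.2.1.2.mono (WithErr.map_le_map hf x)))⟩

/-- Local continuity of the functor at the identity, which is what makes `unfold` a left inverse of
`fold`. -/
theorem exhausts_map {ρ : ℕ → StrictHom X X} (hρ : StrictHom.Exhausts ρ) :
    StrictHom.Exhausts fun n => map (ρ n) (ρ n) :=
  Wedge.exhausts_map .id (Wedge.exhausts_map
    ((WithErr.exhausts_map hρ).prodMap (WithErr.exhausts_map hρ))
    ((WithErr.exhausts_map hρ).arrow (WithErr.exhausts_map hρ)))

/-- The projection to pairs, which sends the other summands to the error. -/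
noncomputable def toPair : StrictHom (DynSum X) (WithErr X × WithErr X) :=
  Wedge.desc .raise (Wedge.desc .id .raise)

/-- The projection to functions, which sends the other summands to the error. -/
noncomputable def toFn : StrictHom (DynSum X) (DomainHom (WithErr X) (WithErr X)) :=
  Wedge.desc .raise (Wedge.desc .raise .id)

end DynSum

/-! ### The tower of approximations. -/

/-- A type with a domain preorder structure. -/
structure BundledDomain where
  carrier : Type
  [str : DomainPreorder carrier]

attribute [instance] BundledDomain.str

/-- The finite approximations to the solution of the domain equation. -/
noncomputable def approx : ℕ → BundledDomain
  -- The one-point domain.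
  | 0 => ⟨Part Empty⟩
  | n + 1 => ⟨DynSum (approx n).carrier⟩

/-- The carrier of an approximation. -/
abbrev Approx (n : ℕ) : Type := (approx n).carrier

namespace Approx

theorem eq_bot_zero (x : Approx 0) : x = ⊥ :=
  Part.eq_none_iff.mpr fun a _ => a.elim

theorem eq_zero (x y : Approx 0) : x = y := (eq_bot_zero x).trans (eq_bot_zero y).symm

/-- The canonical functions between the approximations. -/
noncomputable def trans : ∀ n m : ℕ, StrictHom (Approx n) (Approx m)
  | 0, _ => .zero
  | _ + 1, 0 => .zero
  -- An embedding if `n ≤ m`, a projection if `m ≤ n`. The contravariant slot needs the opposite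
  -- function, so one recursion defines both.
  | n + 1, m + 1 => DynSum.map (trans m n) (trans n m)
termination_by n m => n + m

theorem trans_succ_succ (n m : ℕ) :
    trans (n + 1) (m + 1) = DynSum.map (trans m n) (trans n m) := by rw [trans]

/-- Information is lost only if the middle stage lies strictly below both ends; in that case
`trans_trans_le` still gives an inequality. -/
theorem trans_trans : ∀ n m k : ℕ, (n ≤ m ∨ k ≤ m) →
    (trans m k).comp (trans n m) = trans n k
  | 0, m, k, _ => StrictHom.ext fun x => by simp [eq_bot_zero x]
  | n + 1, m, 0, _ => StrictHom.ext fun x => eq_zero _ _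
  | n + 1, 0, k + 1, h => by omega
  | n + 1, m + 1, k + 1, h => by
    have h₁ := trans_trans n m k (by omega)
    -- The side condition is symmetric in the two ends, so induction also covers the contravariant
    -- composite.
    have h₂ := trans_trans k m n (by omega)
    rw [trans_succ_succ, trans_succ_succ, trans_succ_succ, ← h₁, ← h₂]
    exact StrictHom.ext fun x => DynSum.map_map _ _ _ _ x
termination_by n m k => n + m + k

theorem trans_self : ∀ n : ℕ, trans n n = .id
  | 0 => StrictHom.ext fun x => eq_zero _ _
  | n + 1 => by
    rw [trans_succ_succ, trans_self n]
    exact StrictHom.ext fun x => DynSum.map_id x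

theorem trans_trans_le : ∀ (n m k : ℕ) (x : Approx n), trans m k (trans n m x) ≤ trans n k x
  | 0, m, k, x => by simp [eq_bot_zero x]
  | n + 1, m, 0, x => (eq_zero _ _).le
  | n + 1, 0, k + 1, x => by simp [eq_bot_zero (trans (n + 1) 0 x)]
  | n + 1, m + 1, k + 1, x => by
    rw [trans_succ_succ, trans_succ_succ, trans_succ_succ]
    exact (DynSum.map_map _ _ _ _ x).le.trans
      (DynSum.map_le_map (trans_trans_le k m n) (trans_trans_le n m k) x)
termination_by n m k => n + m + k

end Approx

open Approx

/-! ### The bilimit. -/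

/-- The bilimit of the approximations: the families compatible with the projections. -/
def Bilimit : Type := {x : ∀ n, Approx n // ∀ n m, n ≤ m → trans m n (x m) = x n}

namespace Bilimit

instance : PartialOrder Bilimit := inferInstanceAs (PartialOrder (Subtype _))

/-- The coordinates of a chain. -/
noncomputable def evalChain (c : Chain Bilimit) (n : ℕ) : Chain (Approx n) :=
  c.map ⟨fun x => x.1 n, fun _ _ h => h n⟩

noncomputable instance : DomainPreorder Bilimit where
  ωSup c := ⟨fun n => ωSup (evalChain c n), fun n m h => by
    refine le_antisymm ((trans m n).map_ωSup_le _ fun k => ?_) (ωSup_le _ _ fun k => ?_)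
    · exact ((c k).2 n m h).le.trans (le_ωSup (evalChain c n) k)
    · exact ((c k).2 n m h).ge.trans ((trans m n).mono (le_ωSup (evalChain c m) k))⟩
  le_ωSup c k := fun n => le_ωSup (evalChain c n) k
  ωSup_le c x h := fun n => ωSup_le (evalChain c n) (x.1 n) fun k => h k n
  bot := ⟨fun _ => ⊥, fun n m _ => (trans m n).map_bot⟩
  bot_le x := fun n => (bot_le : ⊥ ≤ x.1 n)
  errLE x y := ∀ n, x.1 n ⊑ y.1 n
  errLE_refl _ _ := DomainPreorder.errLE_refl _
  errLE_trans _ _ _ h k n := DomainPreorder.errLE_trans _ _ _ (h n) (k n)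
  eq_bot_of_bot_errLE _ h :=
    Subtype.ext (funext fun n => DomainPreorder.eq_bot_of_bot_errLE _ (h n))
  errLE_ωSup _ _ h n := DomainPreorder.errLE_ωSup _ _ fun k => h k n

/-- The projection to an approximation. -/
noncomputable def proj (n : ℕ) : StrictHom Bilimit (Approx n) where
  toDomainHom := DomainHom.ofLE (fun x => x.1 n) (fun _ _ h => h n)
    (fun c _ h => ωSup_le (evalChain c n) _ h) (fun _ _ h => h n)
  map_bot' := rfl

/-- The embedding of an approximation. -/
noncomputable def emb (n : ℕ) : StrictHom (Approx n) Bilimit where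
  toDomainHom := DomainHom.ofLE
    (fun x => ⟨fun m => trans n m x, fun k m h =>
      DFunLike.congr_fun (trans_trans n m k (.inr h)) x⟩)
    (fun _ _ h m => (trans n m).mono h)
    (fun c _ h m => (trans n m).map_ωSup_le c fun k => h k m)
    (fun _ _ h m => (trans n m).errMono h)
  map_bot' := Subtype.ext (funext fun m => (trans n m).map_bot)

theorem emb_comp_trans {n m : ℕ} (h : n ≤ m) : (emb m).comp (trans n m) = emb n :=
  StrictHom.ext fun x => Subtype.ext (funext fun k =>
    DFunLike.congr_fun (trans_trans n m k (.inl h)) x)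

theorem trans_comp_proj {n m : ℕ} (h : n ≤ m) : (trans m n).comp (proj m) = proj n :=
  StrictHom.ext fun x => x.2 n m h

theorem exhausts_emb_proj : StrictHom.Exhausts fun n => (emb n).comp (proj n) where
  mono' m n h x k := by
    change trans m k (x.1 m) ≤ trans n k (x.1 n)
    rw [← x.2 m n h]
    exact trans_trans_le n m k (x.1 n)
  le' n x k := by
    change trans n k (x.1 n) ≤ x.1 k
    rcases le_total n k with h | h
    · rw [← x.2 n k h]
      refine (trans_trans_le k n k (x.1 k)).trans ?_
      rw [trans_self]
      exact le_rfl
    · exact (x.2 k n h).le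
  least x z h k := by
    -- Coordinate `k` is already exact at the `k`-th approximant.
    have : trans k k (x.1 k) ≤ z.1 k := h k k
    rwa [trans_self] at this

/-! ### Unfolding and folding are mutually inverse. -/

/-- The stages of the unfolding function. -/
noncomputable def unfoldStage (n : ℕ) : StrictHom Bilimit (DynSum Bilimit) :=
  (DynSum.map (proj n) (emb n)).comp (proj (n + 1))

theorem unfoldStage_mono {n m : ℕ} (h : n ≤ m) (x : Bilimit) :
    unfoldStage n x ≤ unfoldStage m x := by
  -- This makes both stages act on the same element `x.1 (m + 1)`, so that they can be compared slot
  -- by slot.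
  have hx : DynSum.map (trans n m) (trans m n) (x.1 (m + 1)) = x.1 (n + 1) := by
    rw [← x.2 (n + 1) (m + 1) (by omega), trans_succ_succ]
    rfl
  change DynSum.map (proj n) (emb n) (x.1 (n + 1)) ≤ DynSum.map (proj m) (emb m) (x.1 (m + 1))
  rw [← hx]
  refine (DynSum.map_map _ _ _ _ _).le.trans (DynSum.map_le_map (fun y => ?_) (fun y k => ?_) _)
  · change trans n m (y.1 n) ≤ y.1 m
    exact exhausts_emb_proj.le' n y m
  · exact trans_trans_le m n k y

/-- The chain of stages of the unfolding function. -/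
noncomputable def unfoldChain : Chain (DomainHom Bilimit (DynSum Bilimit)) :=
  ⟨fun n => (unfoldStage n).toDomainHom, fun _ _ h x => unfoldStage_mono h x⟩

/-- The unfolding function. -/
noncomputable def unfold : DomainHom Bilimit (DynSum Bilimit) := ωSup unfoldChain

theorem unfoldStage_le_unfold (n : ℕ) (x : Bilimit) : unfoldStage n x ≤ unfold x :=
  le_ωSup unfoldChain n x

theorem apply_unfold_le {Z : Type*} [DomainPreorder Z] (g : StrictHom (DynSum Bilimit) Z)
    {x : Bilimit} {z : Z} (h : ∀ n, g (unfoldStage n x) ≤ z) : g (unfold x) ≤ z :=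
  g.map_ωSup_le (DomainHom.evalChain unfoldChain x) h

/-- The coordinates of the folding function. -/
noncomputable def foldCoord : ∀ n, StrictHom (DynSum Bilimit) (Approx n)
  | 0 => .zero
  | n + 1 => DynSum.map (emb n) (proj n)

theorem trans_comp_foldCoord : ∀ {n m : ℕ}, n ≤ m →
    (trans m n).comp (foldCoord m) = foldCoord n
  | 0, _, _ => StrictHom.ext fun _ => eq_zero _ _
  | _ + 1, 0, h => by omega
  | n + 1, m + 1, h => by
    have h : n ≤ m := by omega
    rw [trans_succ_succ]
    refine StrictHom.ext fun y => (DynSum.map_map _ _ _ _ y).trans ?_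
    rw [emb_comp_trans h, trans_comp_proj h]
    rfl

/-- The folding function. -/
noncomputable def fold : StrictHom (DynSum Bilimit) Bilimit where
  toDomainHom := DomainHom.ofLE
    (fun y => ⟨fun n => foldCoord n y, fun _ _ h =>
      DFunLike.congr_fun (trans_comp_foldCoord h) y⟩)
    (fun _ _ h n => (foldCoord n).mono h)
    (fun c _ h n => (foldCoord n).map_ωSup_le c fun k => h k n)
    (fun _ _ h n => (foldCoord n).errMono h)
  map_bot' := Subtype.ext (funext fun n => (foldCoord n).map_bot)

/-- By definition `proj n ∘ emb m` is `trans m n`, so functoriality leaves the recursion for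
`trans`. -/
theorem foldCoord_unfoldStage (n m : ℕ) (x : Bilimit) :
    foldCoord (n + 1) (unfoldStage m x) = trans (m + 1) (n + 1) (x.1 (m + 1)) := by
  rw [trans_succ_succ]
  exact DynSum.map_map _ _ _ _ _

/-- In coordinate `n + 1` every stage stays below `x`, and stage `n` attains it. -/
theorem fold_unfold (x : Bilimit) : fold (unfold x) = x := by
  refine Subtype.ext (funext fun n => ?_)
  change foldCoord n (unfold x) = x.1 n
  cases n with
  | zero => exact eq_zero _ _
  | succ n =>
    apply le_antisymm
    · refine apply_unfold_le _ fun m => (foldCoord_unfoldStage n m x).le.trans ?_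
      exact exhausts_emb_proj.le' (m + 1) x (n + 1)
    · refine le_trans (le_of_eq ?_) ((foldCoord (n + 1)).mono (unfoldStage_le_unfold n x))
      rw [foldCoord_unfoldStage, trans_self]
      rfl

theorem unfoldStage_fold (n : ℕ) (y : DynSum Bilimit) :
    unfoldStage n (fold y) = DynSum.map ((emb n).comp (proj n)) ((emb n).comp (proj n)) y :=
  DynSum.map_map _ _ _ _ _

theorem unfold_fold (y : DynSum Bilimit) : unfold (fold y) = y := by
  have hy := DynSum.exhausts_map exhausts_emb_proj
  apply le_antisymm
  · exact apply_unfold_le .id fun n => (unfoldStage_fold n y).le.trans (hy.le' n y)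
  · exact hy.least _ _ fun n => (unfoldStage_fold n y).ge.trans (unfoldStage_le_unfold n _)

/-- The bilimit solves the domain equation. -/
noncomputable def iso : DomainIso Bilimit (DynSum Bilimit) where
  hom := unfold
  inv := fold.toDomainHom
  inv_hom := fold_unfold
  hom_inv := unfold_fold

/-- The unfolding function is strict. -/
noncomputable def unfoldStrict : StrictHom Bilimit (DynSum Bilimit) where
  toDomainHom := unfold
  map_bot' := (congrArg unfold fold.map_bot.symm).trans (unfold_fold ⊥)

@[simp] theorem unfoldStrict_fold (y : DynSum Bilimit) : unfoldStrict (fold y) = y :=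
  unfold_fold y

end Bilimit

/-! ### The separation of error from divergence, and the casts. -/

theorem mainTheorem12 :
    ∃ (D : Type) (_ : DomainPreorder D) (i : DomainIso D (DynSum D)),
      -- type error and divergence are separated in the dynamic type, in every context
      (℧ : WithErr D) ≠ ⊥ ∧
      (∀ (G : Type) [DomainPreorder G],
        (∀ t : DomainHom G (WithErr D), (℧ : DomainHom G (WithErr D)) ⊑ t) ∧
        ¬ ((⊥ : DomainHom G (WithErr D)) ⊑ ℧)) ∧
      -- the product casts
      (∃ (e : DomainHom (WithErr D × WithErr D) (WithErr D))
          (p : DomainHom (WithErr D) (WithErr D × WithErr D)),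
        (∀ t, e t = .val (i.inv (.pair t))) ∧
        (∀ t, p (e t) = t) ∧
        p ℧ = ℧ ∧ p ⊥ = ⊥ ∧
        (∀ n, n ≠ ⊥ → p (.val (i.inv (.nat n))) = ℧) ∧
        (∀ f, f ≠ ⊥ → p (.val (i.inv (.fn f))) = ℧)) ∧
      -- the function casts
      (∃ (e : DomainHom (DomainHom (WithErr D) (WithErr D)) (WithErr D))
          (p : DomainHom (WithErr D) (DomainHom (WithErr D) (WithErr D))),
        (∀ f, e f = .val (i.inv (.fn f))) ∧
        (∀ f, p (e f) = f) ∧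
        p ℧ = ℧ ∧ p ⊥ = ⊥ ∧
        (∀ n, n ≠ ⊥ → p (.val (i.inv (.nat n))) = ℧) ∧
        (∀ t, t ≠ ⊥ → p (.val (i.inv (.pair t))) = ℧)) := by
  refine ⟨Bilimit, inferInstance, Bilimit.iso, by rintro ⟨⟩, fun G _ =>
    -- Evaluation at ⊥, a point of every `G`, would give `⊥ ⊑ ℧`, which no constructor of
    -- `WithErr.ErrLE` provides.
    ⟨fun t x => PointedDomainPreorder.mho_errLE (t x), fun h => by cases h ⊥⟩, ?_, ?_⟩
  · refine ⟨((WithErr.valHom.comp Bilimit.fold).comp (Wedge.inrHom.comp Wedge.inlHom)).toDomainHom,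
      (WithErr.lift (DynSum.toPair.comp Bilimit.unfoldStrict)).toDomainHom, fun _ => rfl,
      fun t => ?_, rfl, StrictHom.map_bot _, fun n hn => ?_, fun f hf => ?_⟩
    -- Unfolding cancels the folding inside the embedding; `desc` then selects the summand.
    · exact (congrArg DynSum.toPair (Bilimit.unfoldStrict_fold _)).trans
        ((Wedge.desc_inr _ _ _).trans (Wedge.desc_inl _ _ _))
    · exact (congrArg DynSum.toPair (Bilimit.unfoldStrict_fold _)).trans
        ((Wedge.desc_inl _ _ _).trans (StrictHom.raise_of_ne hn))
    · exact (congrArg DynSum.toPair (Bilimit.unfoldStrict_fold _)).trans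
        ((Wedge.desc_inr _ _ _).trans ((Wedge.desc_inr _ _ _).trans (StrictHom.raise_of_ne hf)))
  · refine ⟨((WithErr.valHom.comp Bilimit.fold).comp (Wedge.inrHom.comp Wedge.inrHom)).toDomainHom,
      (WithErr.lift (DynSum.toFn.comp Bilimit.unfoldStrict)).toDomainHom, fun _ => rfl,
      fun t => ?_, rfl, StrictHom.map_bot _, fun n hn => ?_, fun t ht => ?_⟩
    · exact (congrArg DynSum.toFn (Bilimit.unfoldStrict_fold _)).trans
        ((Wedge.desc_inr _ _ _).trans (Wedge.desc_inr _ _ _))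
    · exact (congrArg DynSum.toFn (Bilimit.unfoldStrict_fold _)).trans
        ((Wedge.desc_inl _ _ _).trans (StrictHom.raise_of_ne hn))
    · exact (congrArg DynSum.toFn (Bilimit.unfoldStrict_fold _)).trans
        ((Wedge.desc_inr _ _ _).trans ((Wedge.desc_inl _ _ _).trans (StrictHom.raise_of_ne ht)))
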